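/- Let $r,d\ge 0$ be integers, let $w_1,\dots,w_d$ be elements of the free group $\mathbb F_r$ of rank $r$, and for each $n$ let $\mu_n$ be the probability measure on $S_n^d$ that is the push-forward of the uniform measure on $S_n^r$ under the map $(g_1,\dots,g_r)\mapsto (w_1(g_1,\dots,g_r),\dots,w_d(g_1,\dots,g_r))$ given by evaluation of the words. A sequence $(\nu_n)_n$ of probability measures $\nu_n$ on $S_n^d$, each invariant under diagonal conjugation by $S_n$, is called a *sofic approximation of the free group* if for every non-trivial $w\in\mathbb F_d$ one has, for independent random tuples $(\sigma_{1,n},\dots,\sigma_{d,n})$ with law $\nu_n$ (that is, for almost every point of $\prod_n S_n^d$ with respect to the product measure $\bigotimes_n \nu_n$), $$\lim_{n\to\infty}\frac{1}{n}\,\bigl|\{i\in\{1,\dots,n\} : w(\sigma_{1,n},\dots,\sigma_{d,n})(i)=i\}\bigr| = 0 .$$ Then $(\mu_n)_n$ is a sofic approximation of the free group if and only if the subgroup of $\mathbb F_r$ generated by $w_1,\dots,w_d$ is free of rank $d$. -/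

import Mathlib

open MeasureTheory ProbabilityTheory Filter Topology

namespace WordSofic

/-- The symmetric group `S_n` is a finite set, with all its subsets measurable. -/
instance permMeasurableSpace (n : ℕ) : MeasurableSpace (Equiv.Perm (Fin n)) := ⊤

instance permDiscrete (n : ℕ) : DiscreteMeasurableSpace (Equiv.Perm (Fin n)) :=
  ⟨fun _ => trivial⟩

/-- The uniform probability measure on `S_n`. -/
noncomputable def unif (n : ℕ) : Measure (Equiv.Perm (Fin n)) :=
  uniformOn Set.univ

instance unif_isProbabilityMeasure (n : ℕ) : IsProbabilityMeasure (unif n) :=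
  isProbabilityMeasure_uniformOn Set.finite_univ Set.univ_nonempty

/-- The value `w(g_1, …, g_r)` of a word `w ∈ F_r`: the image of `w` under the homomorphism
`F_r → G` that maps `x_i` to `g_i`. -/
def wordValue {G : Type*} [Group G] {r : ℕ} (w : FreeGroup (Fin r)) (g : Fin r → G) : G :=
  FreeGroup.lift g w

/-- The map `G^r → G^d` induced by a `d`-tuple of words in `F_r`. -/
def wordMap {G : Type*} [Group G] {r d : ℕ} (w : Fin d → FreeGroup (Fin r))
    (g : Fin r → G) : Fin d → G :=
  fun i => wordValue (w i) g

/-- The measure `(w_1, …, w_d)_* (unif^{⊗ r})` on `S_n^d`. -/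
noncomputable def wordMeasure {r d : ℕ} (w : Fin d → FreeGroup (Fin r)) (n : ℕ) :
    Measure (Fin d → Equiv.Perm (Fin n)) :=
  (Measure.pi fun _ : Fin r => unif n).map (wordMap w)

instance wordMeasure_isProbabilityMeasure {r d : ℕ} (w : Fin d → FreeGroup (Fin r)) (n : ℕ) :
    IsProbabilityMeasure (wordMeasure w n) :=
  Measure.isProbabilityMeasure_map (Measurable.of_discrete).aemeasurable

/-- Invariance of a measure on `S_n^d` under diagonal conjugation by `S_n`. -/
def IsConjInvariant {d n : ℕ} (μ : Measure (Fin d → Equiv.Perm (Fin n))) : Prop :=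
  ∀ g : Equiv.Perm (Fin n), μ.map (fun σ i => g * σ i * g⁻¹) = μ

/-- The proportion of the points of `{1, …, n}` that are fixed by `σ`. -/
noncomputable def fixedProportion {n : ℕ} (σ : Equiv.Perm (Fin n)) : ℝ :=
  (Function.fixedPoints σ).ncard / n

/-- A sequence of conjugation-invariant probability measures `μ n` on `S_n^d` is a sofic
approximation of the free group `F_d` if, for independent random `d`-tuples `σ n` with laws `μ n`
and for every non-trivial word `w ∈ F_d`, the proportion of fixed points of `w(σ n)` tends to `0`
almost surely. -/
def IsSoficApproximation {d : ℕ} (μ : ∀ n : ℕ, Measure (Fin d → Equiv.Perm (Fin n)))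
    [∀ n, IsProbabilityMeasure (μ n)] : Prop :=
  (∀ n, IsConjInvariant (μ n)) ∧
    ∀ w : FreeGroup (Fin d), w ≠ 1 →
      ∀ᵐ σ ∂(Measure.infinitePi μ),
        Tendsto (fun n : ℕ => fixedProportion (wordValue w (σ n))) atTop (𝓝 0)

/-- The subgroup generated by `w_1, …, w_d` is a free group of rank `d`. -/
def GenerateFreeOfRank {G : Type*} [Group G] {d : ℕ} (w : Fin d → G) : Prop :=
  Nonempty (FreeGroupBasis (Fin d) (Subgroup.closure (Set.range w)))

end WordSofic

/-! Evaluating `v` on `wordMap w g` is evaluating `FreeGroup.lift w v` on `g`, so both sides amount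
to injectivity of `FreeGroup.lift w`. If it kills some `v ≠ 1`, then `v` fixes every point almost
surely. Otherwise each `v ≠ 1` gives a non-trivial word in uniform permutations, whose number of
fixed points has bounded moments (`exists_moment_bound`); the second moment of the proportion is
then `O(1/n²)`, which is summable.

The moment bound counts closed trajectories of a cyclically reduced word. They trace a graph with
`V` vertices and `E ≥ V` edges, as nothing backtracks. There are `O(n^V)` labellings, each realised
with probability `O(n^(-E))`.

Injectivity matches freeness of rank `d` because free groups are Hopfian, which follows from
residual finiteness, itself a consequence of the moment bound. -/

namespace WordSofic

/-! ### Permutations with prescribed values -/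

section PartialPermutations

variable {α β : Type*} [Fintype β] [DecidableEq β]

/-- Translation by `τ⁻¹` reduces to the pointwise stabiliser of `A`, the symmetric group of the
complement. -/
theorem card_perm_agree_mul_descFactorial (A : Finset β) (τ : Equiv.Perm β) :
    (Finset.univ.filter fun σ : Equiv.Perm β => ∀ a ∈ A, σ a = τ a).card *
      (Fintype.card β).descFactorial A.card = (Fintype.card β).factorial := by
  have h1 : (Finset.univ.filter fun σ : Equiv.Perm β => ∀ a ∈ A, σ a = τ a).card =
      Fintype.card {σ : Equiv.Perm β // ∀ a, ¬ a ∉ A → σ a = a} := by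
    rw [Fintype.card_subtype]
    refine Finset.card_bij (fun σ _ => τ⁻¹ * σ) ?_ ?_ ?_
    · intro σ hσ
      simp only [Finset.mem_filter, Finset.mem_univ, true_and, not_not] at hσ ⊢
      intro a ha
      simp [hσ a ha]
    · intro σ _ σ' _ h
      exact mul_left_cancel h
    · intro σ hσ
      simp only [Finset.mem_filter, Finset.mem_univ, true_and, not_not] at hσ
      refine ⟨τ * σ, ?_, by simp⟩
      simp only [Finset.mem_filter, Finset.mem_univ, true_and]
      intro a ha
      simp [hσ a ha]
  have h2 := Fintype.card_congr (Equiv.Perm.subtypeEquivSubtypePerm fun a : β => a ∉ A)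
  have h3 : Fintype.card {a : β // a ∉ A} = Fintype.card β - A.card := by
    rw [Fintype.card_subtype_compl]; simp
  rw [h1, ← h2, Fintype.card_perm, h3,
    Nat.factorial_mul_descFactorial (Finset.card_le_univ A)]

theorem card_tuple_agree_mul_pow_le [Fintype α] [DecidableEq α] (D : Finset (α × β))
    (τ : α → Equiv.Perm β) {m : ℕ} (hD : D.card ≤ m) (hm : 2 * m ≤ Fintype.card β) :
    ((Finset.univ.filter fun g : α → Equiv.Perm β => ∀ p ∈ D, g p.1 p.2 = τ p.1 p.2).card : ℝ) *
      ((Fintype.card β : ℝ) / 2) ^ D.card ≤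
        ((Fintype.card β).factorial : ℝ) ^ Fintype.card α := by
  set n := Fintype.card β
  let S : α → Finset β := fun i => Finset.univ.filter fun a => (i, a) ∈ D
  have hset : (Finset.univ.filter fun g : α → Equiv.Perm β => ∀ p ∈ D, g p.1 p.2 = τ p.1 p.2) =
      Fintype.piFinset fun i =>
        Finset.univ.filter fun σ : Equiv.Perm β => ∀ a ∈ S i, σ a = τ i a := by
    ext g
    simp [S, Fintype.mem_piFinset]
  have hsum : D.card = ∑ i, (S i).card := by
    have : D = (Finset.univ.sigma S).map (Equiv.sigmaEquivProd α β).toEmbedding := by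
      ext ⟨i, a⟩
      simp [S]
    conv_lhs => rw [this]
    rw [Finset.card_map, Finset.card_sigma]
  rw [hset, Fintype.card_piFinset, hsum, ← Finset.prod_pow_eq_pow_sum, Nat.cast_prod,
    ← Finset.prod_mul_distrib, ← Finset.card_univ, ← Finset.prod_const]
  refine Finset.prod_le_prod (fun i _ => by positivity) fun i _ => ?_
  rw [← card_perm_agree_mul_descFactorial (S i) (τ i), Nat.cast_mul]
  refine mul_le_mul_of_nonneg_left ?_ (by positivity)
  have hi : (S i).card ≤ m := by
    refine le_trans ?_ hD
    rw [hsum]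
    exact Finset.single_le_sum (f := fun i => (S i).card) (fun _ _ => Nat.zero_le _)
      (Finset.mem_univ i)
  -- Every factor of the falling factorial is at least `n / 2`, since at most `m ≤ n / 2` values are
  -- prescribed.
  have h4 : ((n + 1 - (S i).card : ℕ) : ℝ) ^ (S i).card ≤ n.descFactorial (S i).card := by
    exact_mod_cast Nat.pow_sub_le_descFactorial n (S i).card
  refine le_trans (pow_le_pow_left₀ (by positivity) ?_ _) h4
  rw [div_le_iff₀ (by norm_num)]
  have : n ≤ (n + 1 - (S i).card) * 2 := by omega
  exact_mod_cast this

end PartialPermutations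

/-! ### Labellings counted by number of distinct labels -/

section Images

variable {ι β : Type*} [Fintype ι] [DecidableEq ι] [Fintype β] [DecidableEq β]

theorem card_filter_card_image_le (v : ℕ) :
    (Finset.univ.filter fun t : ι → β => (Finset.univ.image t).card = v).card ≤
      Fintype.card β ^ v * v ^ Fintype.card ι := by
  have h : (Finset.univ.filter fun t : ι → β => (Finset.univ.image t).card = v) ⊆
      Finset.univ.image fun p : (Fin v → β) × (ι → Fin v) => p.1 ∘ p.2 := by
    intro t ht
    simp only [Finset.mem_filter, Finset.mem_univ, true_and] at ht
    let e := (Finset.univ.image t).equivFinOfCardEq ht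
    simp only [Finset.mem_image, Finset.mem_univ, true_and]
    refine ⟨(fun k => (e.symm k : β), fun j => e ⟨t j, by simp⟩), ?_⟩
    ext j
    simp
  calc _ ≤ _ := Finset.card_le_card h
    _ ≤ _ := Finset.card_image_le
    _ = _ := by simp

theorem sum_inv_pow_card_image_le (hβ : 0 < Fintype.card β) :
    ∑ t : ι → β, (((Fintype.card β : ℝ) / 2) ^ (Finset.univ.image t).card)⁻¹ ≤
      ∑ v ∈ Finset.range (Fintype.card ι + 1), (v : ℝ) ^ Fintype.card ι * 2 ^ v := by
  have hmap : ∀ t ∈ (Finset.univ : Finset (ι → β)),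
      (Finset.univ.image t).card ∈ Finset.range (Fintype.card ι + 1) := by
    intro t _
    rw [Finset.mem_range, Nat.lt_succ_iff]
    exact Finset.card_image_le
  rw [← Finset.sum_fiberwise_of_maps_to hmap]
  refine Finset.sum_le_sum fun v _ => ?_
  have hn : (0 : ℝ) < Fintype.card β := by exact_mod_cast hβ
  have hc : ∑ t ∈ Finset.univ.filter fun t : ι → β => (Finset.univ.image t).card = v,
      (((Fintype.card β : ℝ) / 2) ^ (Finset.univ.image t).card)⁻¹ =
      (Finset.univ.filter fun t : ι → β => (Finset.univ.image t).card = v).card *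
        (((Fintype.card β : ℝ) / 2) ^ v)⁻¹ := by
    rw [← nsmul_eq_mul, ← Finset.sum_const]
    refine Finset.sum_congr rfl fun t ht => ?_
    rw [(Finset.mem_filter.1 ht).2]
  have hcard : ((Finset.univ.filter fun t : ι → β => (Finset.univ.image t).card = v).card : ℝ) ≤
      (Fintype.card β : ℝ) ^ v * (v : ℝ) ^ Fintype.card ι := by
    exact_mod_cast card_filter_card_image_le (ι := ι) (β := β) v
  rw [hc]
  refine (mul_le_mul_of_nonneg_right hcard (by positivity)).trans (le_of_eq ?_)
  rw [div_pow]
  field_simp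

end Images

/-! ### Graphs traced by closed trajectories -/

section Trajectories

variable {α β ι : Type*}

/-- The permutation by which a letter of a word acts. -/
def letterAct (g : α → Equiv.Perm β) (l : α × Bool) : Equiv.Perm β :=
  cond l.2 (g l.1) (g l.1)⁻¹

/-- A labelling `t` of the vertices of the `α`-labelled graph with an edge from `nxt j` to `j`,
of label `letter j`, for each `j`, that is compatible with the permutations `g`. -/
def Follows (letter : ι → α × Bool) (nxt : Equiv.Perm ι) (g : α → Equiv.Perm β) (t : ι → β) :
    Prop :=
  ∀ j, t j = letterAct g (letter j) (t (nxt j))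

/-- The pairs `(i, a)` such that the value of the `i`-th permutation at `a` is
determined by the labelling `t`. -/
def edgeSet [Fintype ι] [DecidableEq α] [DecidableEq β] (letter : ι → α × Bool)
    (nxt : Equiv.Perm ι) (t : ι → β) : Finset (α × β) :=
  Finset.univ.image fun j => ((letter j).1, cond (letter j).2 (t (nxt j)) (t j))

theorem Follows.agree [Fintype ι] [DecidableEq α] [DecidableEq β] {letter : ι → α × Bool}
    {nxt : Equiv.Perm ι} {g h : α → Equiv.Perm β} {t : ι → β} (hg : Follows letter nxt g t)
    (hh : Follows letter nxt h t) : ∀ p ∈ edgeSet letter nxt t, g p.1 p.2 = h p.1 p.2 := by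
  intro p hp
  simp only [edgeSet, Finset.mem_image, Finset.mem_univ, true_and] at hp
  obtain ⟨j, rfl⟩ := hp
  have h1 := hg j
  have h2 := hh j
  rcases hl : letter j with ⟨i, _ | _⟩
  · simp only [hl, letterAct, cond_false] at h1 h2 ⊢
    rw [Equiv.Perm.eq_inv_iff_eq] at h1 h2
    rw [h1, h2]
  · simp only [hl, letterAct, cond_true] at h1 h2 ⊢
    rw [← h1, ← h2]

/-- In a graph covered by closed paths without backtracking there are at least as many edges as
vertices. -/
theorem Follows.card_image_le_card_edgeSet [Fintype ι] [DecidableEq α] [DecidableEq β]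
    {letter : ι → α × Bool} {nxt : Equiv.Perm ι} {g : α → Equiv.Perm β} {t : ι → β}
    (hg : Follows letter nxt g t)
    (hred : ∀ j, letter (nxt j) ≠ ((letter j).1, !(letter j).2)) :
    (Finset.univ.image t).card ≤ (edgeSet letter nxt t).card := by
  classical
  let V := Finset.univ.image t
  let E := edgeSet letter nxt t
  have hV : ∀ v : V, ∃ j, t (nxt j) = v := by
    rintro ⟨v, hv⟩
    obtain ⟨j, -, rfl⟩ := Finset.mem_image.1 hv
    exact ⟨nxt.symm j, by simp⟩
  choose J hJ using hV
  -- Two darts leave each vertex: one along the path, one back along it. Their letters differ by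
  -- `hred`. An edge carries at most two darts, so `2|V| ≤ 2|E|`.
  let dart : V × Bool → (α × Bool) × β := fun p =>
    (cond p.2 (letter (J p.1)) ((letter (nxt (J p.1))).1, !(letter (nxt (J p.1))).2), p.1)
  have hdart : Function.Injective dart := by
    rintro ⟨v, b⟩ ⟨v', b'⟩ h
    have hv : v = v' := Subtype.ext (congrArg Prod.snd h)
    subst hv
    have hl := congrArg Prod.fst h
    have hne := hred (J v)
    rcases b with _ | _ <;> rcases b' with _ | _ <;> simp only [dart, cond_true, cond_false] at hl
    · rfl
    · exact absurd (by rw [← hl]; simp) hne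
    · exact absurd (by rw [hl]; simp) hne
    · rfl
  let edge : (α × Bool) × β → (α × β) × Bool := fun q =>
    ((q.1.1, cond q.1.2 q.2 ((g q.1.1)⁻¹ q.2)), q.1.2)
  have hedge : Function.Injective edge := by
    rintro ⟨⟨i, b⟩, a⟩ ⟨⟨i', b'⟩, a'⟩ h
    simp only [edge, Prod.mk.injEq] at h
    obtain ⟨⟨rfl, h2⟩, rfl⟩ := h
    rcases b with _ | _
    · simpa using h2
    · simpa using h2
  have hfwd : ∀ j, (edge (letter j, t (nxt j))).1 ∈ E := by
    intro j
    refine Finset.mem_image.2 ⟨j, Finset.mem_univ _, ?_⟩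
    have := hg j
    rcases hl : letter j with ⟨i, _ | _⟩ <;> simp_all [edge, letterAct]
  have hbwd : ∀ j, (edge (((letter j).1, !(letter j).2), t j)).1 ∈ E := by
    intro j
    refine Finset.mem_image.2 ⟨j, Finset.mem_univ _, ?_⟩
    have := hg j
    rcases hl : letter j with ⟨i, _ | _⟩ <;> simp_all [edge, letterAct]
  have hmem : ∀ p, edge (dart p) ∈ E ×ˢ (Finset.univ : Finset Bool) := by
    rintro ⟨v, b⟩
    refine Finset.mem_product.2 ⟨?_, Finset.mem_univ _⟩
    rcases b with _ | _
    · have := hbwd (nxt (J v))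
      rwa [hJ] at this
    · have := hfwd (J v)
      rwa [hJ] at this
  have := Finset.card_le_card_of_injOn (s := (Finset.univ : Finset (V × Bool)))
    (fun p => edge (dart p)) (fun p _ => hmem p) (hedge.comp hdart).injOn
  simp only [Finset.card_univ, Fintype.card_prod, Fintype.card_coe, Fintype.card_bool,
    Finset.card_product] at this
  exact Nat.le_of_mul_le_mul_right this two_pos

open Classical in
theorem sum_card_follows_le [Fintype α] [DecidableEq α] [Fintype β] [DecidableEq β] [Fintype ι]
    [DecidableEq ι]
    (letter : ι → α × Bool) (nxt : Equiv.Perm ι)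
    (hred : ∀ j, letter (nxt j) ≠ ((letter j).1, !(letter j).2))
    (hβ : 0 < Fintype.card β) (hι : 2 * (Fintype.card ι + 1) ≤ Fintype.card β) :
    ∑ g : α → Equiv.Perm β,
      ((Finset.univ.filter fun t : ι → β => Follows letter nxt g t).card : ℝ) ≤
      (∑ v ∈ Finset.range (Fintype.card ι + 1), (v : ℝ) ^ Fintype.card ι * 2 ^ v) *
        ((Fintype.card β).factorial : ℝ) ^ Fintype.card α := by
  have hswap : ∑ g : α → Equiv.Perm β,
      ((Finset.univ.filter fun t : ι → β => Follows letter nxt g t).card : ℝ) =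
      ∑ t : ι → β,
        ((Finset.univ.filter fun g : α → Equiv.Perm β => Follows letter nxt g t).card : ℝ) := by
    simp only [Finset.card_filter, Nat.cast_sum]
    exact Finset.sum_comm
  rw [hswap]
  refine le_trans ?_ (mul_le_mul_of_nonneg_right (sum_inv_pow_card_image_le hβ) (by positivity))
  rw [Finset.sum_mul]
  refine Finset.sum_le_sum fun t _ => ?_
  rcases (Finset.univ.filter fun g : α → Equiv.Perm β =>
    Follows letter nxt g t).eq_empty_or_nonempty with h0 | ⟨g₀, hg₀⟩
  · rw [h0]
    simp only [Finset.card_empty, Nat.cast_zero]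
    positivity
  replace hg₀ := (Finset.mem_filter.1 hg₀).2
  have h1 := card_tuple_agree_mul_pow_le (edgeSet letter nxt t) g₀ (m := Fintype.card ι)
    Finset.card_image_le (by omega)
  have hsub : (Finset.univ.filter fun g : α → Equiv.Perm β => Follows letter nxt g t) ⊆
      Finset.univ.filter fun g : α → Equiv.Perm β =>
        ∀ p ∈ edgeSet letter nxt t, g p.1 p.2 = g₀ p.1 p.2 := by
    intro g hg
    exact Finset.mem_filter.2 ⟨Finset.mem_univ _, (Finset.mem_filter.1 hg).2.agree hg₀⟩
  -- A base of at least 1 lets the exponent drop from the number of edges to that of vertices.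
  have hone : (1 : ℝ) ≤ (Fintype.card β : ℝ) / 2 := by
    rw [le_div_iff₀ two_pos]
    have : 1 * 2 ≤ Fintype.card β := by omega
    exact_mod_cast this
  rw [inv_mul_eq_div, le_div_iff₀ (by positivity)]
  refine le_trans (mul_le_mul ?_ ?_ (by positivity) (by positivity)) h1
  · exact_mod_cast Finset.card_le_card hsub
  · exact pow_le_pow_right₀ hone (hg₀.card_image_le_card_edgeSet hred)

end Trajectories

/-! ### Fixed points of words in random permutations -/

section Words

variable {α β : Type*}

theorem lift_mk_eq_prod_letterAct (g : α → Equiv.Perm β) (L : List (α × Bool)) :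
    FreeGroup.lift g (FreeGroup.mk L) = (L.map (letterAct g)).prod := by
  rw [FreeGroup.lift_mk]
  rfl

theorem IsCyclicallyReduced.getElem_finRotate_ne {L : List (α × Bool)} {k : ℕ}
    (hL : FreeGroup.IsCyclicallyReduced L) (hk : L.length = k + 1) (j : Fin (k + 1)) :
    L[(finRotate (k + 1) j : ℕ)]'(by omega) ≠
      ((L[(j : ℕ)]'(by omega)).1, !(L[(j : ℕ)]'(by omega)).2) := by
  intro h
  have key : (L[(j : ℕ)]'(by omega)).1 = (L[(finRotate (k + 1) j : ℕ)]'(by omega)).1 →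
      (L[(j : ℕ)]'(by omega)).2 = (L[(finRotate (k + 1) j : ℕ)]'(by omega)).2 := by
    rcases eq_or_ne j (Fin.last k) with rfl | hj
    · refine hL.2 _ ?_ _ ?_
      · simp [List.getLast?_eq_getElem?, hk]
      · simp [List.head?_eq_getElem?, hk]
    · have hr := coe_finRotate_of_ne_last hj
      simp only [hr]
      have hj' : (j : ℕ) < k := Fin.val_lt_last hj
      exact List.isChain_iff_getElem.1 hL.1 j (by omega)
  have h2 := key (by rw [h])
  rw [h] at h2
  simp at h2

/-- The closed trajectories of the points `x i`, each fixed by the word `L`. -/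
theorem follows_suffix_prod {κ : Type*} {L : List (α × Bool)} {k : ℕ} (hk : L.length = k + 1)
    (g : α → Equiv.Perm β) (x : κ → β)
    (hx : ∀ i, FreeGroup.lift g (FreeGroup.mk L) (x i) = x i) :
    Follows (fun p : κ × Fin (k + 1) => L[(p.2 : ℕ)]'(by omega))
      (Equiv.prodCongr (Equiv.refl κ) (finRotate (k + 1))) g
      (fun p => ((L.drop p.2).map (letterAct g)).prod (x p.1)) := by
  rintro ⟨i, j⟩
  have hdrop : L.drop j = L[(j : ℕ)]'(by omega) :: L.drop (j + 1) :=
    List.drop_eq_getElem_cons (by omega)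
  simp only [Equiv.prodCongr_apply, Prod.map_apply, Equiv.refl_apply]
  rw [hdrop, List.map_cons, List.prod_cons, Equiv.Perm.mul_apply]
  congr 1
  rcases eq_or_ne j (Fin.last k) with rfl | hj
  -- At the last letter the remaining suffix is empty; the path closes up because `L` fixes `x i`.
  · have := hx i
    rw [lift_mk_eq_prod_letterAct] at this
    simp [this, ← hk]
  · rw [coe_finRotate_of_ne_last hj]

open Classical in
theorem card_fixed_pow_le_card_follows [Fintype β] {L : List (α × Bool)} {k : ℕ} (m : ℕ)
    (hk : L.length = k + 1) (g : α → Equiv.Perm β) :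
    (Function.fixedPoints (FreeGroup.lift g (FreeGroup.mk L))).ncard ^ m ≤
      (Finset.univ.filter fun t : Fin m × Fin (k + 1) → β =>
        Follows (fun p : Fin m × Fin (k + 1) => L[(p.2 : ℕ)]'(by omega))
          (Equiv.prodCongr (Equiv.refl _) (finRotate (k + 1))) g t).card := by
  set F := Function.fixedPoints (FreeGroup.lift g (FreeGroup.mk L))
  have hF : F.ncard ^ m = (Finset.univ : Finset (Fin m → F)).card := by
    rw [Finset.card_univ, Fintype.card_fun, Fintype.card_fin, ← Nat.card_eq_fintype_card,
      Nat.card_coe_set_eq]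
  rw [hF]
  refine Finset.card_le_card_of_injOn
    (fun x p => ((L.drop p.2).map (letterAct g)).prod (x p.1 : β)) ?_ ?_
  · intro x _
    simp only [Finset.coe_filter, Finset.mem_univ, true_and, Set.mem_ofPred_eq]
    exact follows_suffix_prod hk g (fun i => (x i : β)) fun i => (x i).2
  · intro x _ y _ h
    funext i
    have hi := congrFun h (i, 0)
    have hx := (x i).2
    have hy := (y i).2
    simp only [F, Function.mem_fixedPoints, Function.IsFixedPt,
      lift_mk_eq_prod_letterAct] at hx hy
    simp only [Fin.val_zero, List.drop_zero] at hi
    exact Subtype.ext (hx.symm.trans (hi.trans hy))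

theorem ncard_fixedPoints_conj (σ τ : Equiv.Perm β) :
    (Function.fixedPoints (τ * σ * τ⁻¹)).ncard = (Function.fixedPoints σ).ncard := by
  have : Function.fixedPoints (τ * σ * τ⁻¹) = τ '' Function.fixedPoints σ := by
    ext x
    simp only [Function.mem_fixedPoints, Function.IsFixedPt, Equiv.Perm.mul_apply, Set.mem_image]
    constructor
    · intro h
      exact ⟨τ⁻¹ x, by rw [Equiv.Perm.eq_inv_iff_eq, h], by simp⟩
    · rintro ⟨y, hy, rfl⟩
      simp [hy]
  rw [this, Set.ncard_image_of_injective _ τ.injective]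

theorem exists_conj_isCyclicallyReduced {w : FreeGroup α} (hw : w ≠ 1) :
    ∃ (L : List (α × Bool)) (u : FreeGroup α), FreeGroup.IsCyclicallyReduced L ∧ L ≠ [] ∧
      w = u * FreeGroup.mk L * u⁻¹ := by
  classical
  refine ⟨FreeGroup.reduceCyclically w.toWord, FreeGroup.mk (FreeGroup.reduceCyclically.conjugator
    w.toWord), FreeGroup.reduceCyclically.isCyclicallyReduced FreeGroup.isReduced_toWord, ?_⟩
  have h : w = FreeGroup.mk (FreeGroup.reduceCyclically.conjugator w.toWord) *
      FreeGroup.mk (FreeGroup.reduceCyclically w.toWord) *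
      (FreeGroup.mk (FreeGroup.reduceCyclically.conjugator w.toWord))⁻¹ := by
    rw [FreeGroup.inv_mk, FreeGroup.mul_mk, FreeGroup.mul_mk,
      FreeGroup.reduceCyclically.conj_conjugator_reduceCyclically, FreeGroup.mk_toWord]
  refine ⟨fun h0 => hw ?_, h⟩
  rw [h, h0, ← FreeGroup.one_eq_mk, mul_one, mul_inv_cancel]

/-- The moments of the number of fixed points of a non-trivial word in uniform random permutations
are bounded uniformly in the degree of the permutations. -/
theorem exists_moment_bound {r : ℕ} {w : FreeGroup (Fin r)} (hw : w ≠ 1) (m : ℕ) :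
    ∃ C : ℝ, 0 ≤ C ∧ ∀ n : ℕ, ∑ g : Fin r → Equiv.Perm (Fin n),
      ((Function.fixedPoints (wordValue w g : Equiv.Perm (Fin n))).ncard : ℝ) ^ m ≤ C * (n.factorial : ℝ) ^ r := by
  classical
  obtain ⟨L, u, hL, hne, rfl⟩ := exists_conj_isCyclicallyReduced hw
  obtain ⟨k, hk⟩ : ∃ k, L.length = k + 1 :=
    Nat.exists_eq_succ_of_ne_zero fun h => hne (List.length_eq_zero_iff.1 h)
  have hconj : ∀ (n : ℕ) (g : Fin r → Equiv.Perm (Fin n)),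
      (Function.fixedPoints (wordValue (u * FreeGroup.mk L * u⁻¹) g : Equiv.Perm (Fin n))).ncard =
        (Function.fixedPoints (FreeGroup.lift g (FreeGroup.mk L))).ncard := by
    intro n g
    rw [wordValue, map_mul, map_mul, map_inv, ncard_fixedPoints_conj]
  simp only [hconj]
  obtain ⟨N, hN⟩ : ∃ N, Fintype.card (Fin m × Fin (k + 1)) = N := ⟨_, rfl⟩
  set C₁ : ℝ := ∑ v ∈ Finset.range (N + 1), (v : ℝ) ^ N * 2 ^ v
  -- `C₂` covers small degrees, where the trivial bound `n ^ m` suffices.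
  set C₂ : ℝ := ((2 * (N + 1) : ℕ) : ℝ) ^ m
  have hC₁ : 0 ≤ C₁ := Finset.sum_nonneg fun v _ => by positivity
  have hC₂ : 0 ≤ C₂ := by positivity
  refine ⟨C₁ + C₂, by positivity, fun n => ?_⟩
  rcases le_total (2 * (N + 1)) n with hn | hn
  · have hfol := sum_card_follows_le (β := Fin n)
      (fun p : Fin m × Fin (k + 1) => L[(p.2 : ℕ)]'(by omega))
      (Equiv.prodCongr (Equiv.refl _) (finRotate (k + 1)))
      (fun p => IsCyclicallyReduced.getElem_finRotate_ne hL hk p.2)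
      (by rw [Fintype.card_fin]; omega) (by rw [Fintype.card_fin, hN]; exact hn)
    rw [hN, Fintype.card_fin, Fintype.card_fin] at hfol
    refine le_trans (Finset.sum_le_sum fun g _ => ?_)
      (hfol.trans (mul_le_mul_of_nonneg_right (le_add_of_nonneg_right hC₂) (by positivity)))
    rw [← Nat.cast_pow]
    exact Nat.cast_le.2 (card_fixed_pow_le_card_follows m hk g)
  · calc _ ≤ ∑ g : Fin r → Equiv.Perm (Fin n), C₂ := by
          refine Finset.sum_le_sum fun g _ => pow_le_pow_left₀ (by positivity) ?_ _
          have h1 := Set.ncard_le_card (Function.fixedPoints (FreeGroup.lift g (FreeGroup.mk L)))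
          rw [Nat.card_eq_fintype_card, Fintype.card_fin] at h1
          exact Nat.cast_le.2 (h1.trans hn)
      _ = C₂ * (n.factorial : ℝ) ^ r := by
          rw [Finset.sum_const, Finset.card_univ, Fintype.card_fun, Fintype.card_perm,
            Fintype.card_fin, Fintype.card_fin, nsmul_eq_mul, Nat.cast_pow, mul_comm]
      _ ≤ _ := mul_le_mul_of_nonneg_right (le_add_of_nonneg_left hC₁) (by positivity)

/-! ### Residual finiteness, Hopficity and the injectivity criterion -/

/-- Non-trivial elements of a free group are detected by homomorphisms to symmetric groups. -/
theorem exists_wordValue_ne_one {r : ℕ} {w : FreeGroup (Fin r)} (hw : w ≠ 1) :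
    ∃ (n : ℕ) (g : Fin r → Equiv.Perm (Fin n)), wordValue w g ≠ 1 := by
  by_contra! h
  obtain ⟨C, -, hC⟩ := exists_moment_bound hw 1
  obtain ⟨n, hn⟩ := exists_nat_gt C
  have hfix : ∀ g : Fin r → Equiv.Perm (Fin n),
      (Function.fixedPoints (wordValue w g : Equiv.Perm (Fin n))).ncard = n := by
    intro g
    rw [h n g, Equiv.Perm.coe_one, Function.fixedPoints_id, Set.ncard_univ,
      Nat.card_eq_fintype_card, Fintype.card_fin]
  have h1 := hC n
  simp only [hfix, pow_one, Finset.sum_const, Finset.card_univ, Fintype.card_fun,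
    Fintype.card_perm, Fintype.card_fin, nsmul_eq_mul, Nat.cast_pow] at h1
  rw [mul_comm] at h1
  have h2 := le_of_mul_le_mul_right h1 (by positivity)
  linarith

/-- Free groups of finite rank are Hopfian. -/
theorem injective_of_surjective_freeGroup {d : ℕ} (f : FreeGroup (Fin d) →* FreeGroup (Fin d))
    (hf : Function.Surjective f) : Function.Injective f := by
  rw [injective_iff_map_eq_one]
  intro w hw
  by_contra hne
  obtain ⟨n, g, hg⟩ := exists_wordValue_ne_one hne
  -- Malcev's argument: precomposition with `f` is an injective self-map of the finite set of
  -- homomorphisms to `S_n`, so every such homomorphism factors through `f` and kills its kernel.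
  let Φ : (Fin d → Equiv.Perm (Fin n)) → (Fin d → Equiv.Perm (Fin n)) :=
    fun h => FreeGroup.lift.symm ((FreeGroup.lift h).comp f)
  have hΦ : Function.Injective Φ := by
    intro h h' heq
    have h1 := FreeGroup.lift.symm.injective heq
    exact FreeGroup.lift.injective ((MonoidHom.cancel_right hf).1 h1)
  obtain ⟨h, hh⟩ := Finite.surjective_of_injective hΦ g
  apply hg
  have h2 : FreeGroup.lift g = (FreeGroup.lift h).comp f := by
    rw [← hh, Equiv.apply_symm_apply]
  rw [wordValue, h2, MonoidHom.comp_apply, hw, map_one]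

theorem closure_range_eq_range_lift {G : Type*} [Group G] {d : ℕ} (w : Fin d → G) :
    Subgroup.closure (Set.range w) = (FreeGroup.lift w).range :=
  FreeGroup.range_lift_eq_closure.symm

/-- The given basis may have nothing to do with `w`; Hopficity shows that `w` is itself a basis. -/
theorem generateFreeOfRank_iff_injective {r d : ℕ} (w : Fin d → FreeGroup (Fin r)) :
    GenerateFreeOfRank w ↔ Function.Injective (FreeGroup.lift w) := by
  rw [GenerateFreeOfRank, closure_range_eq_range_lift]
  constructor
  · rintro ⟨b⟩
    have h := injective_of_surjective_freeGroup
      (b.repr.toMonoidHom.comp (FreeGroup.lift w).rangeRestrict)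
      (b.repr.surjective.comp (FreeGroup.lift w).rangeRestrict_surjective)
    rw [MonoidHom.coe_comp] at h
    exact MonoidHom.rangeRestrict_injective_iff.1 h.of_comp
  · intro h
    exact ⟨FreeGroupBasis.ofRepr (MonoidHom.ofInjective h).symm⟩

theorem wordValue_wordMap {G : Type*} [Group G] {r d : ℕ} (w : Fin d → FreeGroup (Fin r))
    (v : FreeGroup (Fin d)) (g : Fin r → G) :
    wordValue v (wordMap w g) = wordValue (FreeGroup.lift w v) g := by
  have : FreeGroup.lift (wordMap w g) = (FreeGroup.lift g).comp (FreeGroup.lift w) := by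
    ext i
    simp [wordMap, wordValue]
  rw [wordValue, this]
  rfl

theorem wordMap_conj {G : Type*} [Group G] {r d : ℕ} (w : Fin d → FreeGroup (Fin r))
    (h : G) (g : Fin r → G) :
    wordMap w (fun i => h * g i * h⁻¹) = fun i => h * wordMap w g i * h⁻¹ := by
  have : FreeGroup.lift (fun i => h * g i * h⁻¹) =
      (MulAut.conj h).toMonoidHom.comp (FreeGroup.lift g) := by
    ext i
    simp
  funext i
  rw [wordMap, wordValue, this]
  rfl

end Words

/-! ### Word measures and almost sure convergence -/

section Measures

theorem pi_unif_singleton {r n : ℕ} (g : Fin r → Equiv.Perm (Fin n)) :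
    (Measure.pi fun _ : Fin r => unif n) {g} = ((n.factorial : ENNReal) ^ r)⁻¹ := by
  rw [Measure.pi_singleton]
  simp [unif, uniformOn_univ, Fintype.card_perm, ENNReal.inv_pow]

theorem isConjInvariant_wordMeasure {r d : ℕ} (w : Fin d → FreeGroup (Fin r)) (n : ℕ) :
    IsConjInvariant (wordMeasure w n) := by
  intro h
  have hpi : (Measure.pi fun _ : Fin r => unif n).map
      (fun g : Fin r → Equiv.Perm (Fin n) => fun i => h * g i * h⁻¹) =
      Measure.pi fun _ : Fin r => unif n := by
    refine Measure.ext_of_singleton fun g => ?_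
    rw [Measure.map_apply Measurable.of_discrete (MeasurableSet.singleton g)]
    have : (fun g : Fin r → Equiv.Perm (Fin n) => fun i => h * g i * h⁻¹) ⁻¹' {g} =
        {fun i => h⁻¹ * g i * h} := by
      ext g'
      simp only [Set.mem_preimage, Set.mem_singleton_iff]
      constructor
      · rintro rfl
        funext i
        group
      · rintro rfl
        funext i
        group
    rw [this, pi_unif_singleton, pi_unif_singleton]
  have hcomm : (fun (σ : Fin d → Equiv.Perm (Fin n)) i => h * σ i * h⁻¹) ∘ wordMap w =
      wordMap w ∘ fun (g : Fin r → Equiv.Perm (Fin n)) i => h * g i * h⁻¹ := by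
    funext g
    exact (wordMap_conj w h g).symm
  rw [wordMeasure, Measure.map_map Measurable.of_discrete Measurable.of_discrete, hcomm,
    ← Measure.map_map Measurable.of_discrete Measurable.of_discrete, hpi]

theorem lintegral_fixedProportion_sq_le {r d : ℕ} (w : Fin d → FreeGroup (Fin r))
    (v : FreeGroup (Fin d)) {C : ℝ} {n : ℕ}
    (hC : ∑ g : Fin r → Equiv.Perm (Fin n),
      ((Function.fixedPoints
        (wordValue (FreeGroup.lift w v) g : Equiv.Perm (Fin n))).ncard : ℝ) ^ 2 ≤
        C * (n.factorial : ℝ) ^ r) :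
    ∫⁻ σ, ENNReal.ofReal (fixedProportion (wordValue v σ) ^ 2) ∂(wordMeasure w n) ≤
      ENNReal.ofReal (C * (1 / (n : ℝ) ^ 2)) := by
  rw [wordMeasure, lintegral_map Measurable.of_discrete Measurable.of_discrete, lintegral_fintype]
  simp only [pi_unif_singleton, wordValue_wordMap]
  have hfac : ((n.factorial : ENNReal) ^ r)⁻¹ = ENNReal.ofReal (((n.factorial : ℝ) ^ r)⁻¹) := by
    rw [ENNReal.ofReal_inv_of_pos (by positivity), ENNReal.ofReal_pow (by positivity),
      ENNReal.ofReal_natCast]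
  have hterm : ∀ g : Fin r → Equiv.Perm (Fin n),
      ENNReal.ofReal (fixedProportion (wordValue (FreeGroup.lift w v) g) ^ 2) *
        ((n.factorial : ENNReal) ^ r)⁻¹ =
      ENNReal.ofReal (fixedProportion (wordValue (FreeGroup.lift w v) g) ^ 2 *
        ((n.factorial : ℝ) ^ r)⁻¹) := by
    intro g
    rw [hfac, ENNReal.ofReal_mul (by positivity)]
  simp only [hterm]
  rw [← ENNReal.ofReal_sum_of_nonneg fun g _ => by positivity]
  refine ENNReal.ofReal_le_ofReal ?_
  rw [← Finset.sum_mul]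
  simp only [fixedProportion, div_pow]
  rw [← Finset.sum_div, ← div_eq_mul_inv, div_le_iff₀ (by positivity), div_eq_mul_one_div]
  calc _ ≤ (C * (n.factorial : ℝ) ^ r) * (1 / (n : ℝ) ^ 2) :=
        mul_le_mul_of_nonneg_right hC (by positivity)
    _ = _ := by ring

/-- The sum of the squared proportions has finite expectation, so it converges almost surely. Only
the marginal laws matter. The first moment would give only the non-summable bound `O(1/n)`. -/
theorem ae_tendsto_fixedProportion {r d : ℕ} (w : Fin d → FreeGroup (Fin r))
    {v : FreeGroup (Fin d)} (hv : FreeGroup.lift w v ≠ 1) :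
    ∀ᵐ σ ∂(Measure.infinitePi (wordMeasure w)),
      Tendsto (fun n : ℕ => fixedProportion (wordValue v (σ n))) atTop (𝓝 0) := by
  obtain ⟨C, hC0, hC⟩ := exists_moment_bound hv 2
  let f : ∀ n : ℕ, (Fin d → Equiv.Perm (Fin n)) → ENNReal :=
    fun n σ => ENNReal.ofReal (fixedProportion (wordValue v σ) ^ 2)
  have hmeas : ∀ n, Measurable fun σ : (∀ n : ℕ, Fin d → Equiv.Perm (Fin n)) => f n (σ n) :=
    fun n => (Measurable.of_discrete (f := f n)).comp (measurable_pi_apply n)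
  have hint : ∀ n, ∫⁻ σ, f n (σ n) ∂(Measure.infinitePi (wordMeasure w)) ≤
      ENNReal.ofReal (C * (1 / (n : ℝ) ^ 2)) := by
    intro n
    rw [(measurePreserving_eval_infinitePi (wordMeasure w) n).lintegral_comp
      (Measurable.of_discrete (f := f n))]
    exact lintegral_fixedProportion_sq_le w v (hC n)
  have hsum : ∫⁻ σ, ∑' n, f n (σ n) ∂(Measure.infinitePi (wordMeasure w)) ≠ ⊤ := by
    rw [lintegral_tsum fun n => (hmeas n).aemeasurable]
    refine ne_top_of_le_ne_top ?_ (ENNReal.tsum_le_tsum hint)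
    exact ((Real.summable_one_div_nat_pow.2 one_lt_two).mul_left C).tsum_ofReal_ne_top
  filter_upwards [ae_lt_top (Measurable.tsum hmeas) hsum] with σ hσ
  have h1 := ENNReal.tendsto_atTop_zero_of_tsum_ne_top hσ.ne
  have h2 := (ENNReal.tendsto_toReal ENNReal.zero_ne_top).comp h1
  have h3 := (Real.continuous_sqrt.tendsto 0).comp h2
  simp only [Real.sqrt_zero] at h3
  refine h3.congr fun n => ?_
  have hnn : 0 ≤ fixedProportion (wordValue v (σ n)) := by
    unfold fixedProportion; positivity
  simp only [Function.comp_apply, f]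
  rw [ENNReal.toReal_ofReal (by positivity), Real.sqrt_sq hnn]

theorem not_ae_tendsto_fixedProportion {r d : ℕ} (w : Fin d → FreeGroup (Fin r))
    {v : FreeGroup (Fin d)} (hv : FreeGroup.lift w v = 1) :
    ¬ ∀ᵐ σ ∂(Measure.infinitePi (wordMeasure w)),
      Tendsto (fun n : ℕ => fixedProportion (wordValue v (σ n))) atTop (𝓝 0) := by
  intro h
  have hone : ∀ n, ∀ᵐ σ ∂(Measure.infinitePi (wordMeasure w)), wordValue v (σ n) = 1 := by
    intro n
    refine (measurePreserving_eval_infinitePi (wordMeasure w) n).quasiMeasurePreserving.ae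
      (p := fun τ => wordValue v τ = 1) ?_
    rw [wordMeasure, ae_map_iff Measurable.of_discrete.aemeasurable .of_discrete]
    refine Eventually.of_forall fun g => ?_
    rw [wordValue_wordMap, hv, wordValue, map_one]
  obtain ⟨σ, hσ, hσ1⟩ := (h.and (ae_all_iff.2 hone)).exists
  have hev : (fun _ : ℕ => (1 : ℝ)) =ᶠ[atTop] fun n => fixedProportion (wordValue v (σ n)) := by
    -- In degree 0 the proportion is `0 / 0 = 0`, hence the exclusion.
    filter_upwards [eventually_gt_atTop 0] with n hn
    have hn' : (n : ℝ) ≠ 0 := by exact_mod_cast hn.ne'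
    rw [hσ1 n, fixedProportion, Equiv.Perm.coe_one, Function.fixedPoints_id, Set.ncard_univ,
      Nat.card_eq_fintype_card, Fintype.card_fin, div_self hn']
  exact one_ne_zero (tendsto_nhds_unique (tendsto_const_nhds.congr' hev) hσ)

end Measures

end WordSofic

theorem proposition4p2 (r d : ℕ) (w : Fin d → FreeGroup (Fin r)) :
    WordSofic.IsSoficApproximation (WordSofic.wordMeasure w) ↔
      WordSofic.GenerateFreeOfRank w := by
  rw [WordSofic.generateFreeOfRank_iff_injective, injective_iff_map_eq_one]
  constructor
  · rintro ⟨-, h⟩ v hv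
    by_contra hne
    exact WordSofic.not_ae_tendsto_fixedProportion w hv (h v hne)
  · intro h
    exact ⟨WordSofic.isConjInvariant_wordMeasure w, fun v hv =>
      WordSofic.ae_tendsto_fixedProportion w fun h1 => hv (h v h1)⟩
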